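/- A randomized one-sample algorithm on $[0,1]$ is a pair $A=(p,g)$, where $p$ is a Borel probability measure on $[0,1]$ and $g\colon[0,1]\times\mathbb{R}\to\mathbb{R}$ is a Borel measurable prediction function: the algorithm draws a location $x\sim p$, reads the value $f(x)$, and outputs $g(x,f(x))$ as its estimate of the average $\int_0^1 f(t)\,dt$ of the unknown function $f\colon[0,1]\to\mathbb{R}$. Its worst-case expected error is $$W(A)=\sup_{f}\int_{[0,1]}\left|g(x,f(x))-\int_0^1 f(t)\,dt\right|\,dp(x)\in[0,\infty],$$ where the supremum is over all $1$-Lipschitz functions $f\colon[0,1]\to\mathbb{R}$. Theorem. Let $A^*$ be the algorithm that samples $x$ uniformly from $[2-\sqrt3,\,\sqrt3-1]$ and outputs the observed value, i.e. $g(x,y)=y$. Then $W(A^*)\le W(A)$ for every randomized one-sample algorithm $A$, and $$W(A^*)=1-\frac{\sqrt3}{2}\approx 0.134$$ (with $\left|1-\frac{\sqrt3}{2}-0.134\right|<0.0005$). -/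

import Mathlib

open MeasureTheory
open scoped ENNReal unitInterval

/-- The average of a function `f` on the unit interval, that is, its Lebesgue integral
over `[0,1]`. -/
noncomputable def avg (f : I → ℝ) : ℝ := ∫ x, f x

/-- A randomized one-sample algorithm on `[0,1]`: the law of the sampling location, and a
prediction function `predict x y`, the estimate of the average that is output when the value
`y` is read at the location `x`. -/
structure SamplingAlgorithm where
  law : ProbabilityMeasure I
  predict : I → ℝ → ℝ
  measurable_predict : Measurable (Function.uncurry predict)

namespace SamplingAlgorithm

/-- The expected absolute estimation error of the algorithm `A` on the input `f`. It takes values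
in `[0, ∞]`, since a prediction function may have infinite expected error. -/
noncomputable def expectedError (A : SamplingAlgorithm) (f : I → ℝ) : ℝ≥0∞ :=
  ∫⁻ x, ENNReal.ofReal |A.predict x (f x) - avg f| ∂(A.law : Measure I)

/-- The worst-case expected error of `A`: the supremum of its expected error over all
1-Lipschitz functions on `[0,1]`. -/
noncomputable def worstCaseError (A : SamplingAlgorithm) : ℝ≥0∞ :=
  ⨆ f : {f : I → ℝ // LipschitzWith 1 f}, A.expectedError f

end SamplingAlgorithm

/-- The interval `[2 - √3, √3 - 1]`, as a subset of `[0,1]`. -/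
def middleInterval : Set I := {x | (x : ℝ) ∈ Set.Icc (2 - √3) (√3 - 1)}

theorem volume_middleInterval_ne_zero : volume middleInterval ≠ 0 := by
  have h1 : (3 / 2 : ℝ) < √3 := Real.lt_sqrt_of_sq_lt (by norm_num)
  have h2 : √3 ≤ 2 := Real.sqrt_le_iff.mpr (by norm_num)
  have hsub : Set.Icc (2 - √3) (√3 - 1) ⊆ Subtype.val '' middleInterval := fun x hx =>
    ⟨⟨x, by linarith [hx.1], by linarith [hx.2]⟩, hx, rfl⟩
  have hpos : 0 < volume (Set.Icc (2 - √3) (√3 - 1)) := by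
    rw [Real.volume_Icc, ENNReal.ofReal_pos]; linarith
  rw [unitInterval.volume_apply]
  exact (hpos.trans_le (measure_mono hsub)).ne'

/-- The uniform distribution on `[2 - √3, √3 - 1]`: Lebesgue measure on `[0,1]` conditioned on
that interval. -/
noncomputable def uniformMiddle : ProbabilityMeasure I :=
  ⟨ProbabilityTheory.cond volume middleInterval,
    ProbabilityTheory.cond_isProbabilityMeasure volume_middleInterval_ne_zero⟩

/-- The algorithm that samples uniformly from `[2 - √3, √3 - 1]` and outputs the observed
value. -/
noncomputable def uniformMiddleAlgorithm : SamplingAlgorithm where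
  law := uniformMiddle
  predict := fun _ y => y
  measurable_predict := measurable_snd

/-! Put a = 2 - √3, a root of a² = 4a - 1; the claimed value is a/2.

Upper bound: subtracting the mean leaves a 1-Lipschitz F with ∫ F = 0, and `integral_abs_middle_le`
shows that |F| has integral at most (1 - 2a)a/2 over [a, 1 - a]. Without a zero there, F has
constant sign and `integral_middle_le` applies. Otherwise the least and greatest zeros cut [0, 1]
into five parts. Cone bounds control each part, and a multiple of ∫ F = 0 is added to trade the
middle against the two ends; the outer signs differ or agree.

Lower bound: test against ±h + k, with h(x) = |x - c| - a, c = (1 ± a)/2 and k uniform on [-M, M].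
The condition a² = 4a - 1 gives h mean zero. Up to boundary effects a reading y does not reveal the
sign, so the mean is equally likely y - h(x) or y + h(x), and any guess errs by at least |h(x)| on
average. Averaging over the two c gives a/2 at every x (`abs_add_abs_ge`). Then M → ∞. -/

/-! ### Cone bounds for integrals of 1-Lipschitz functions -/

theorem le_add_abs_of_lipschitzWith_one {F : ℝ → ℝ} (hF : LipschitzWith 1 F) (x y : ℝ) :
    F x ≤ F y + |x - y| := by
  have h := hF.dist_le_mul x y
  rw [Real.dist_eq, Real.dist_eq, NNReal.coe_one, one_mul] at h
  linarith [le_abs_self (F x - F y)]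

theorem integral_le_of_lipschitzWith_one_left {F : ℝ → ℝ} (hF : LipschitzWith 1 F) {l h : ℝ}
    (hlh : l ≤ h) : ∫ x in l..h, F x ≤ F l * (h - l) + (h - l) ^ 2 / 2 := by
  have hle : ∫ x in l..h, F x ≤ ∫ x in l..h, (F l + (x - l)) := by
    refine intervalIntegral.integral_mono_on hlh (hF.continuous.intervalIntegrable _ _)
      (Continuous.intervalIntegrable (by fun_prop) _ _) fun x hx => ?_
    have := le_add_abs_of_lipschitzWith_one hF x l
    rwa [abs_of_nonneg (by linarith [hx.1])] at this
  refine hle.trans_eq ?_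
  rw [intervalIntegral.integral_add (by simp) (Continuous.intervalIntegrable (by fun_prop) _ _),
    intervalIntegral.integral_sub (by simp) (by simp)]
  simp only [intervalIntegral.integral_const, integral_id, smul_eq_mul]
  ring

theorem LipschitzWith.one_comp_reflect {F : ℝ → ℝ} (hF : LipschitzWith 1 F) (c : ℝ) :
    LipschitzWith 1 fun x => F (c - x) := by
  refine LipschitzWith.of_dist_le_mul fun x y => ?_
  have h := hF.dist_le_mul (c - x) (c - y)
  rwa [dist_sub_left] at h

theorem integral_le_of_lipschitzWith_one_right {F : ℝ → ℝ} (hF : LipschitzWith 1 F) {l h : ℝ}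
    (hlh : l ≤ h) : ∫ x in l..h, F x ≤ F h * (h - l) + (h - l) ^ 2 / 2 := by
  have := integral_le_of_lipschitzWith_one_left (hF.one_comp_reflect (l + h)) hlh
  rw [intervalIntegral.integral_comp_sub_left (fun x => F x)] at this
  simpa using this

theorem integral_le_of_lipschitzWith_one {F : ℝ → ℝ} (hF : LipschitzWith 1 F) {l h : ℝ}
    (hlh : l ≤ h) :
    ∫ x in l..h, F x ≤ (h - l + F l + F h) ^ 2 / 4 - (F l ^ 2 + F h ^ 2) / 2 := by
  have h1 := le_add_abs_of_lipschitzWith_one hF l h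
  have h2 := le_add_abs_of_lipschitzWith_one hF h l
  rw [abs_of_nonneg (by linarith)] at h2
  rw [abs_of_nonpos (by linarith)] at h1
  -- The upper cones from the two endpoints cross at p.
  obtain ⟨p, hp⟩ : ∃ p, p = (h + l + F h - F l) / 2 := ⟨_, rfl⟩
  have h3 := integral_le_of_lipschitzWith_one_left hF (l := l) (h := p) (by linarith)
  have h4 := integral_le_of_lipschitzWith_one_right hF (l := p) (h := h) (by linarith)
  rw [← intervalIntegral.integral_add_adjacent_intervals
    (hF.continuous.intervalIntegrable l p) (hF.continuous.intervalIntegrable p h)]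
  refine (add_le_add h3 h4).trans_eq ?_
  rw [hp]; ring

/-! ### Quadratic inequalities for the five parts -/

/-- The estimate when the signs on the two outer parts of the middle interval differ. The
variables are the lengths `l`, `m`, `r` of the three parts, the absolute values `u`, `v` at the two
endpoints and the integrals over the five parts of `[0, 1]`. -/
theorem integral_bound_of_opposite_signs {a l m r u v I₀ I₁ I₂ J I₃ I₄ : ℝ}
    (ha : a ^ 2 = 4 * a - 1) (ha0 : 0 < a) (ha1 : a < 0.268)
    (hl : 0 ≤ l) (hm : 0 ≤ m) (hsum : l + m + r = 1 - 2 * a) (hlr : l ≤ r)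
    (hul : u ≤ l)
    (h₀ : I₀ ≤ u * a + a ^ 2 / 2) (h₁ : I₁ ≤ (l + u) ^ 2 / 4 - u ^ 2 / 2)
    (h₂ : I₂ ≤ J) (hJ : J ≤ m ^ 2 / 4) (h₃ : -I₃ ≤ (r + v) ^ 2 / 4 - v ^ 2 / 2)
    (h₄ : I₄ ≤ -v * a + a ^ 2 / 2) (h0 : I₀ + I₁ + I₂ + I₃ + I₄ = 0) :
    I₁ + J - I₃ ≤ (1 - 2 * a) * a / 2 := by
  -- The difference n serves as Lagrange multiplier: n(I₀ + I₁ + I₂ + I₃ + I₄) = 0 is added to the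
  -- target.
  obtain ⟨n, hn⟩ : ∃ n, n = r - l := ⟨_, rfl⟩
  have hn0 : 0 ≤ n := by linarith
  have hn1 : n + m ≤ 1 - 2 * a := by linarith
  have hn2 : 0 < 1 - n := by linarith
  have e1 : (1 + n) * I₁ ≤ (1 + n) * (l ^ 2 / 2) :=
    mul_le_mul_of_nonneg_left (by nlinarith [sq_nonneg (l - u)]) (by linarith)
  have e0 : n * I₀ ≤ n * (l * a + a ^ 2 / 2) :=
    mul_le_mul_of_nonneg_left (by nlinarith) hn0
  have e2 : n * I₂ + J ≤ (1 + n) * (m ^ 2 / 4) := by nlinarith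
  have e3 : (1 - n) * (-I₃) + n * I₄ ≤
      (1 - n) * (r ^ 2 / 2) + n ^ 2 * a ^ 2 / (1 - n) - n * a * r + n * a ^ 2 / 2 := by
    have e31 := mul_le_mul_of_nonneg_left h₃ hn2.le
    have e32 := mul_le_mul_of_nonneg_left h₄ hn0
    -- Completing the square in r - v eliminates v.
    have e33 : n ^ 2 * a ^ 2 / (1 - n) = ((1 - n) * (r - v) / 2 - n * a) ^ 2 / (1 - n)
        - (1 - n) * (r - v) ^ 2 / 4 + n * a * (r - v) := by
      field_simp; ring
    have e34 : 0 ≤ ((1 - n) * (r - v) / 2 - n * a) ^ 2 / (1 - n) := by positivity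
    nlinarith
  have e4 : I₁ + J - I₃ ≤ (1 + n) * (l ^ 2 / 2) + n * (l * a + a ^ 2 / 2) + (1 + n) * (m ^ 2 / 4)
      + ((1 - n) * (r ^ 2 / 2) + n ^ 2 * a ^ 2 / (1 - n) - n * a * r + n * a ^ 2 / 2) := by
    have : I₂ = -I₀ - I₁ - I₃ - I₄ := by linarith
    subst this
    linarith
  refine e4.trans ?_
  have hl' : l = (1 - 2 * a - m - n) / 2 := by linarith
  have hr' : r = (1 - 2 * a - m + n) / 2 := by linarith
  -- A gap m > 0 between the zeros cannot increase the bound.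
  have e5 : m * (-2 * (1 - 2 * a) + 2 * n ^ 2 + (2 + n) * m) ≤ 0 := by
    refine mul_nonpos_of_nonneg_of_nonpos hm ?_
    nlinarith [mul_nonneg hn0 (by linarith : 0 ≤ 1 + 2 * a - n),
      mul_nonneg (by linarith : 0 ≤ 2 + n) (by linarith : 0 ≤ 1 - 2 * a - n - m)]
  have e6 : (1 - 2 * a) ^ 2 / 4 - n ^ 2 / 4 + n * a ^ 2 / (1 - n) ≤ (1 - 2 * a) * a / 2 := by
    -- The relation a² = 4a - 1 is what produces the double root n = a.
    have : (1 - 2 * a) ^ 2 / 4 - n ^ 2 / 4 + n * a ^ 2 / (1 - n) - (1 - 2 * a) * a / 2 =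
        -((n - a) ^ 2 * (1 - 2 * a - n)) / 4 / (1 - n) := by
      have ha3 : a ^ 3 = 15 * a - 4 := by
        calc a ^ 3 = a * a ^ 2 := by ring
          _ = _ := by rw [ha]; linear_combination 4 * ha
      field_simp
      ring_nf
      simp only [ha3, ha]
      ring
    have h7 : 0 ≤ (n - a) ^ 2 * (1 - 2 * a - n) / 4 / (1 - n) :=
      div_nonneg (div_nonneg (mul_nonneg (sq_nonneg _) (by linarith)) (by norm_num)) hn2.le
    have h8 : -((n - a) ^ 2 * (1 - 2 * a - n)) / 4 / (1 - n) =
      -((n - a) ^ 2 * (1 - 2 * a - n) / 4 / (1 - n)) := by ring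
    linarith
  have e7 : (1 + n) * (l ^ 2 / 2) + n * (l * a + a ^ 2 / 2) + (1 + n) * (m ^ 2 / 4)
      + ((1 - n) * (r ^ 2 / 2) + n ^ 2 * a ^ 2 / (1 - n) - n * a * r + n * a ^ 2 / 2) =
      ((1 - 2 * a) ^ 2 / 4 - n ^ 2 / 4 + n * a ^ 2 / (1 - n)) +
        m * (-2 * (1 - 2 * a) + 2 * n ^ 2 + (2 + n) * m) / 4 := by
    rw [hl', hr']
    field_simp
    ring
  linarith

/-- The estimate when the signs on the two outer parts of the middle interval agree; the notation
is that of `integral_bound_of_opposite_signs`. -/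
theorem integral_bound_of_same_sign {a l m r u v I₀ I₁ I₂ J I₃ I₄ : ℝ}
    (ha0 : 0.2679 < a) (ha1 : a < 0.268)
    (hm : 0 ≤ m) (hr : 0 ≤ r) (hsum : l + m + r = 1 - 2 * a) (hrl : r ≤ l)
    (hv : 0 ≤ v)
    (h₀ : I₀ ≤ -u * a + a ^ 2 / 2) (h₁ : -I₁ ≤ (l + u) ^ 2 / 4 - u ^ 2 / 2)
    (h₂ : I₂ ≤ J) (hJ : J ≤ m ^ 2 / 4) (h₃ : -I₃ ≤ (r + v) ^ 2 / 4 - v ^ 2 / 2)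
    (h₄ : I₄ ≤ -v * a + a ^ 2 / 2) (h0 : I₀ + I₁ + I₂ + I₃ + I₄ = 0) :
    -I₁ + J - I₃ ≤ (1 - 2 * a) * a / 2 := by
  have hK : (0.0621 : ℝ) < (1 - 2 * a) * a / 2 := by nlinarith
  rcases le_total l 0.31 with hl | hl
  -- When neither outer part is long, the mean-zero condition is not needed; 0.4642 bounds 1 - 2a
  -- from above.
  · have e1 : -I₁ ≤ l ^ 2 / 2 := by linarith [sq_nonneg (l - u)]
    have e3 : -I₃ ≤ r ^ 2 / 2 := by linarith [sq_nonneg (r - v)]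
    have hw : 0 ≤ 0.4642 - l - r := by linarith
    have hm2 : m ^ 2 ≤ (0.4642 - l - r) ^ 2 := pow_le_pow_left₀ hm (by linarith) 2
    have : l ^ 2 / 2 + r ^ 2 / 2 + (0.4642 - l - r) ^ 2 / 4 ≤ 0.0621 := by
      nlinarith [mul_nonneg hr hw, mul_nonneg hr (sub_nonneg.2 hrl),
        mul_nonneg (hr.trans hrl) (sub_nonneg.2 hl), mul_nonneg hw (sub_nonneg.2 hl),
        mul_nonneg hr (sub_nonneg.2 hl)]
    linarith
  -- The multiplier of the mean-zero condition is now 4/9, a rational close to the optimal one for m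
  -- = r = 0.
  · have e1 : (5 : ℝ) / 9 * ((l + u) ^ 2 / 4 - u ^ 2 / 2) - 4 / 9 * u * a ≤
        5 / 18 * l ^ 2 - 4 / 9 * a * l + 16 / 45 * a ^ 2 := by
      linarith [sq_nonneg (5 / 9 * (l - u) / 2 - 4 / 9 * a)]
    have e3' : (5 : ℝ) / 9 * ((r + v) ^ 2 / 4 - v ^ 2 / 2) - 4 / 9 * v * a ≤ 5 / 36 * r ^ 2 := by
      linarith [mul_nonneg hv (by linarith : 0 ≤ 4 / 9 * a - 5 / 18 * r), mul_nonneg hv hv]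
    have key : -I₁ + J - I₃ ≤ 5 / 18 * l ^ 2 - 4 / 9 * a * l + 16 / 45 * a ^ 2 + 5 / 36 * r ^ 2
        + 4 / 9 * a ^ 2 + 13 / 36 * m ^ 2 := by
      have : I₂ = -I₀ - I₁ - I₃ - I₄ := by linarith
      subst this
      linarith
    refine key.trans ?_
    have hl2 : l = 1 - 2 * a - (m + r) := by linarith
    have hs : 0 ≤ 0.1543 - (m + r) := by linarith
    have hfin : 5 / 18 * (1 - 2 * a) ^ 2 - 4 / 9 * a * (1 - 2 * a) + 16 / 45 * a ^ 2
        + 4 / 9 * a ^ 2 ≤ (1 - 2 * a) * a / 2 := by nlinarith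
    have hq : 5 / 36 * r ^ 2 + 13 / 36 * m ^ 2 ≤ 13 / 36 * (m + r) ^ 2 := by
      linarith [mul_nonneg hm hr, sq_nonneg r]
    have hq0 : 0 ≤ m + r := by linarith
    rw [hl2]
    linarith [mul_nonneg hq0 (by linarith : 0 ≤ 5 / 9 * (1 - 2 * a) - 4 / 9 * a - 23 / 36 * (m + r))]

/-! ### The sharp bound for |F| on the middle interval -/

theorem pos_or_neg_of_isPreconnected {F : ℝ → ℝ} (hF : Continuous F) {s : Set ℝ}
    (hs : IsPreconnected s) (h : ∀ x ∈ s, F x ≠ 0) :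
    (∀ x ∈ s, 0 < F x) ∨ ∀ x ∈ s, F x < 0 := by
  by_contra! hcon
  obtain ⟨⟨x, hx, hx0⟩, y, hy, hy0⟩ := hcon
  obtain ⟨z, hz, hz0⟩ := hs.intermediate_value hx hy hF.continuousOn ⟨hx0, hy0⟩
  exact h z hz hz0

theorem integral_middle_le {F : ℝ → ℝ} (hF : LipschitzWith 1 F) {a : ℝ} (ha0 : 0 ≤ a)
    (ha1 : a ≤ 1 / 2) (hle : ∫ x in (0 : ℝ)..1, F x = 0) :
    ∫ x in a..(1 - a), F x ≤ (1 - 2 * a) * a / 2 := by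
  have hi : ∀ p q, IntervalIntegrable F volume p q := hF.continuous.intervalIntegrable
  have hi' : ∀ p q, IntervalIntegrable (fun x => -F x) volume p q :=
    hF.neg.continuous.intervalIntegrable
  have h0 := integral_le_of_lipschitzWith_one_right hF.neg (l := 0) (h := a) ha0
  have h1 := integral_le_of_lipschitzWith_one_left hF (l := a) (h := 1 / 2) ha1
  have h2 := integral_le_of_lipschitzWith_one_right hF (l := 1 / 2) (h := 1 - a) (by linarith)
  have h3 := integral_le_of_lipschitzWith_one_left hF.neg (l := 1 - a) (h := 1) (by linarith)
  simp only [Pi.neg_apply, intervalIntegral.integral_neg] at h0 h3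
  have e1 := intervalIntegral.integral_add_adjacent_intervals (hi a (1 / 2)) (hi (1 / 2) (1 - a))
  have e2 := intervalIntegral.integral_add_adjacent_intervals (hi 0 a) (hi a (1 - a))
  have e3 := intervalIntegral.integral_add_adjacent_intervals (hi 0 (1 - a)) (hi (1 - a) 1)
  rw [hle] at e3
  -- With weights 2a inside and 1 - 2a outside, the terms in F(a) and F(1 - a) cancel.
  have h12 := mul_le_mul_of_nonneg_left (add_le_add h1 h2) (by linarith : 0 ≤ 2 * a)
  have h03 := mul_le_mul_of_nonneg_left (add_le_add h0 h3) (by linarith : 0 ≤ 1 - 2 * a)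
  have key : ∫ x in a..(1 - a), F x =
      2 * a * ((∫ x in a..(1 / 2), F x) + ∫ x in (1 / 2)..(1 - a), F x) +
      (1 - 2 * a) * (-(∫ x in (0 : ℝ)..a, F x) + -∫ x in (1 - a)..1, F x) := by
    rw [e1]
    linear_combination (1 - 2 * a) * e3 + (1 - 2 * a) * e2
  rw [key]
  linarith

theorem integral_abs_of_nonneg {F : ℝ → ℝ} {l h : ℝ} (hlh : l ≤ h)
    (hF : ∀ x ∈ Set.Icc l h, 0 ≤ F x) : ∫ x in l..h, |F x| = ∫ x in l..h, F x :=
  intervalIntegral.integral_congr fun x hx => by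
    rw [Set.uIcc_of_le hlh] at hx
    exact abs_of_nonneg (hF x hx)

theorem integral_abs_of_nonpos {F : ℝ → ℝ} {l h : ℝ} (hlh : l ≤ h)
    (hF : ∀ x ∈ Set.Icc l h, F x ≤ 0) : ∫ x in l..h, |F x| = -∫ x in l..h, F x := by
  rw [← intervalIntegral.integral_neg]
  exact intervalIntegral.integral_congr fun x hx => by
    rw [Set.uIcc_of_le hlh] at hx
    exact abs_of_nonpos (hF x hx)

set_option maxHeartbeats 800000 in
/-- The main estimate for a function that vanishes at two points `y ≤ z` of the middle interval
and has constant sign on either side of them. -/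
theorem integral_abs_middle_le_of_zeros {F : ℝ → ℝ} (hF : LipschitzWith 1 F) {a y z : ℝ}
    (ha : a ^ 2 = 4 * a - 1) (ha0 : 0.2679 < a) (ha1 : a < 0.268)
    (hF0 : ∫ x in (0 : ℝ)..1, F x = 0) (hy1 : a ≤ y) (hyz : y ≤ z) (hz2 : z ≤ 1 - a)
    (hy0 : F y = 0) (hz0 : F z = 0) (hl : ∀ x ∈ Set.Icc a y, 0 ≤ F x)
    (hright : (∀ x ∈ Set.Icc z (1 - a), 0 ≤ F x) ∨ ∀ x ∈ Set.Icc z (1 - a), F x ≤ 0) :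
    ∫ x in a..(1 - a), |F x| ≤ (1 - 2 * a) * a / 2 := by
  have hc := hF.continuous
  have hi : ∀ p q, IntervalIntegrable F volume p q := hc.intervalIntegrable
  have hi' : ∀ p q, IntervalIntegrable (fun x => |F x|) volume p q := hc.abs.intervalIntegrable
  have eF : (∫ x in (0 : ℝ)..a, F x) + (∫ x in a..y, F x) + (∫ x in y..z, F x) +
      (∫ x in z..(1 - a), F x) + (∫ x in (1 - a)..1, F x) = 0 := by
    rw [intervalIntegral.integral_add_adjacent_intervals (hi _ _) (hi _ _),
      intervalIntegral.integral_add_adjacent_intervals (hi _ _) (hi _ _),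
      intervalIntegral.integral_add_adjacent_intervals (hi _ _) (hi _ _),
      intervalIntegral.integral_add_adjacent_intervals (hi _ _) (hi _ _), hF0]
  have eA : (∫ x in a..y, |F x|) + (∫ x in y..z, |F x|) + (∫ x in z..(1 - a), |F x|) =
      ∫ x in a..(1 - a), |F x| := by
    rw [intervalIntegral.integral_add_adjacent_intervals (hi' _ _) (hi' _ _),
      intervalIntegral.integral_add_adjacent_intervals (hi' _ _) (hi' _ _)]
  have habs := abs_le.1 (intervalIntegral.abs_integral_le_integral_abs (f := F) (μ := volume) hyz)
  have hJ : ∫ x in y..z, |F x| ≤ (z - y) ^ 2 / 4 := by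
    have hFa : LipschitzWith 1 fun x => |F x| := by
      simpa [Function.comp_def] using lipschitzWith_one_norm.comp hF
    refine (integral_le_of_lipschitzWith_one hFa hyz).trans_eq ?_
    simp only [hy0, hz0, abs_zero]
    ring
  have t0 := integral_le_of_lipschitzWith_one_right hF (l := 0) (h := a) (by linarith)
  have t0' := integral_le_of_lipschitzWith_one_right hF.neg (l := 0) (h := a) (by linarith)
  have t1 := integral_le_of_lipschitzWith_one hF hy1
  have t1' := integral_le_of_lipschitzWith_one hF.neg hy1
  have t3 := integral_le_of_lipschitzWith_one hF hz2
  have t3' := integral_le_of_lipschitzWith_one hF.neg hz2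
  have t4 := integral_le_of_lipschitzWith_one_left hF (l := 1 - a) (h := 1) (by linarith)
  have t4' := integral_le_of_lipschitzWith_one_left hF.neg (l := 1 - a) (h := 1) (by linarith)
  have b1 := le_add_abs_of_lipschitzWith_one hF a y
  have b1' := le_add_abs_of_lipschitzWith_one hF y a
  have b3 := le_add_abs_of_lipschitzWith_one hF (1 - a) z
  have b3' := le_add_abs_of_lipschitzWith_one hF z (1 - a)
  rw [abs_of_nonpos (by linarith)] at b1 b3'
  rw [abs_of_nonneg (by linarith)] at b1' b3
  simp only [Pi.neg_apply, intervalIntegral.integral_neg, hy0, hz0] at t0 t0' t1 t1' t3 t3' t4 t4' b1 b1' b3 b3'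
  rw [← eA]
  rw [integral_abs_of_nonneg hy1 hl]
  have hua := hl a ⟨le_rfl, hy1⟩
  rcases hright with hr | hr
  · rw [integral_abs_of_nonneg hz2 hr]
    have hvb := hr (1 - a) ⟨hz2, le_rfl⟩
    -- Reflection lets the longer outer part play the role of l; F is negated to match the signs.
    rcases le_total (y - a) (1 - a - z) with hlen | hlen
    · have := integral_bound_of_same_sign (l := 1 - a - z) (m := z - y) (r := y - a)
        (u := F (1 - a)) (v := F a)
        (I₀ := -(∫ x in (1 - a)..1, F x))
        (I₁ := -(∫ x in z..(1 - a), F x))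
        (I₂ := -(∫ x in y..z, F x))
        (J := ∫ x in y..z, |F x|)
        (I₃ := -(∫ x in a..y, F x))
        (I₄ := -(∫ x in (0 : ℝ)..a, F x))
        ha0 ha1 (by linarith) (by linarith) (by ring) hlen (by linarith)
        (by linarith) (by linarith) (by linarith) hJ (by linarith) (by linarith) (by linarith)
      linarith
    · have := integral_bound_of_same_sign (l := y - a) (m := z - y) (r := 1 - a - z)
        (u := F a) (v := F (1 - a))
        (I₀ := -(∫ x in (0 : ℝ)..a, F x))
        (I₁ := -(∫ x in a..y, F x))
        (I₂ := -(∫ x in y..z, F x))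
        (J := ∫ x in y..z, |F x|)
        (I₃ := -(∫ x in z..(1 - a), F x))
        (I₄ := -(∫ x in (1 - a)..1, F x))
        ha0 ha1 (by linarith) (by linarith) (by ring) hlen (by linarith)
        (by linarith) (by linarith) (by linarith) hJ (by linarith) (by linarith) (by linarith)
      linarith
  · rw [integral_abs_of_nonpos hz2 hr]
    have hvb := hr (1 - a) ⟨hz2, le_rfl⟩
    -- Here l must be the shorter part; reflecting swaps the signs, so F is negated as well.
    rcases le_total (y - a) (1 - a - z) with hlen | hlen
    · have := integral_bound_of_opposite_signs (l := y - a) (m := z - y) (r := 1 - a - z)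
        (u := F a) (v := -F (1 - a))
        (I₀ := ∫ x in (0 : ℝ)..a, F x)
        (I₁ := ∫ x in a..y, F x)
        (I₂ := ∫ x in y..z, F x)
        (J := ∫ x in y..z, |F x|)
        (I₃ := ∫ x in z..(1 - a), F x)
        (I₄ := ∫ x in (1 - a)..1, F x)
        ha (by linarith) ha1 (by linarith) (by linarith) (by ring) hlen (by linarith)
        (by linarith) (by linarith) (by linarith) hJ (by linarith) (by linarith) (by linarith)
      linarith
    · have := integral_bound_of_opposite_signs (l := 1 - a - z) (m := z - y) (r := y - a)
        (u := -F (1 - a)) (v := F a)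
        (I₀ := -(∫ x in (1 - a)..1, F x))
        (I₁ := -(∫ x in z..(1 - a), F x))
        (I₂ := -(∫ x in y..z, F x))
        (J := ∫ x in y..z, |F x|)
        (I₃ := -(∫ x in a..y, F x))
        (I₄ := -(∫ x in (0 : ℝ)..a, F x))
        ha (by linarith) ha1 (by linarith) (by linarith) (by ring) hlen (by linarith)
        (by linarith) (by linarith) (by linarith) hJ (by linarith) (by linarith) (by linarith)
      linarith

theorem integral_abs_middle_le {F : ℝ → ℝ} (hF : LipschitzWith 1 F) {a : ℝ}
    (ha : a ^ 2 = 4 * a - 1) (ha0 : 0.2679 < a) (ha1 : a < 0.268)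
    (hF0 : ∫ x in (0 : ℝ)..1, F x = 0) :
    ∫ x in a..(1 - a), |F x| ≤ (1 - 2 * a) * a / 2 := by
  have hab : a ≤ 1 - a := by linarith
  have hc := hF.continuous
  by_cases hz : ∀ x ∈ Set.Icc a (1 - a), F x ≠ 0
  · rcases pos_or_neg_of_isPreconnected hc isPreconnected_Icc hz with h | h
    · rw [integral_abs_of_nonneg hab fun x hx => (h x hx).le]
      exact integral_middle_le hF (by linarith) (by linarith) hF0
    · rw [integral_abs_of_nonpos hab fun x hx => (h x hx).le, ← intervalIntegral.integral_neg]
      exact integral_middle_le hF.neg (by linarith) (by linarith) (by simp [hF0])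
  push Not at hz
  have hZc : IsCompact (Set.Icc a (1 - a) ∩ F ⁻¹' {0}) :=
    isCompact_Icc.inter_right (isClosed_singleton.preimage hc)
  have hZn : (Set.Icc a (1 - a) ∩ F ⁻¹' {0}).Nonempty := hz
  obtain ⟨y, ⟨⟨hy1, hy2⟩, hy0⟩, hy⟩ := hZc.exists_isLeast hZn
  obtain ⟨z, ⟨⟨hz1, hz2⟩, hz0⟩, hz⟩ := hZc.exists_isGreatest hZn
  have hyz : y ≤ z := hy ⟨⟨hz1, hz2⟩, hz0⟩
  rw [Set.mem_preimage, Set.mem_singleton_iff] at hy0 hz0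
  have hleft : (∀ x ∈ Set.Icc a y, 0 ≤ F x) ∨ ∀ x ∈ Set.Icc a y, F x ≤ 0 := by
    refine (pos_or_neg_of_isPreconnected hc (isPreconnected_Ico (a := a) (b := y))
      fun x hx hx0 => hx.2.not_ge (hy ⟨⟨hx.1, by linarith [hx.2]⟩, hx0⟩)).imp ?_ ?_
    all_goals
      intro h x hx
      rcases hx.2.eq_or_lt with rfl | hlt
      · linarith
      · exact (h x ⟨hx.1, hlt⟩).le
  have hright : (∀ x ∈ Set.Icc z (1 - a), 0 ≤ F x) ∨ ∀ x ∈ Set.Icc z (1 - a), F x ≤ 0 := by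
    refine (pos_or_neg_of_isPreconnected hc (isPreconnected_Ioc (a := z) (b := 1 - a))
      fun x hx hx0 => hx.1.not_ge (hz ⟨⟨by linarith [hx.1], hx.2⟩, hx0⟩)).imp ?_ ?_
    all_goals
      intro h x hx
      rcases hx.1.eq_or_lt with rfl | hlt
      · linarith
      · exact (h x ⟨hlt, hx.2⟩).le
  rcases hleft with hl | hl
  · exact integral_abs_middle_le_of_zeros hF ha ha0 ha1 hF0 hy1 hyz hz2 hy0 hz0 hl hright
  · have := integral_abs_middle_le_of_zeros hF.neg ha ha0 ha1 (by simp [hF0]) hy1 hyz hz2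
      (by simp [hy0]) (by simp [hz0]) (fun x hx => neg_nonneg.2 (hl x hx))
      (hright.symm.imp (fun h x hx => neg_nonneg.2 (h x hx)) fun h x hx => neg_nonpos.2 (h x hx))
    simpa using this

/-! ### Error of the uniform algorithm -/

theorem avg_comp_coe (F : ℝ → ℝ) : avg (fun x : I => F x) = ∫ x in (0 : ℝ)..1, F x := by
  rw [avg, intervalIntegral.integral_of_le zero_le_one, ← integral_Icc_eq_integral_Ioc]
  exact integral_subtype measurableSet_Icc F

theorem volume_middleInterval :
    volume middleInterval = ENNReal.ofReal (1 - 2 * (2 - √3)) := by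
  have h2 : √3 ≤ 2 := Real.sqrt_le_iff.mpr (by norm_num)
  have h := unitInterval.measurePreserving_coe.measure_preimage_emb
    unitInterval.measurableEmbedding_coe (Set.Icc (2 - √3) (√3 - 1))
  rw [Measure.restrict_apply measurableSet_Icc, Set.inter_eq_left.2
    (Set.Icc_subset_Icc (by linarith) (by linarith)), Real.volume_Icc] at h
  exact h.trans (congrArg _ (by ring))

theorem lintegral_middleInterval (G : ℝ → ℝ≥0∞) :
    ∫⁻ x in middleInterval, G x = ∫⁻ x in Set.Icc (2 - √3) (√3 - 1), G x := by
  have h2 : √3 ≤ 2 := Real.sqrt_le_iff.mpr (by norm_num)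
  have h := unitInterval.measurePreserving_coe.setLIntegral_comp_preimage_emb
    unitInterval.measurableEmbedding_coe G (Set.Icc (2 - √3) (√3 - 1))
  rw [Measure.restrict_restrict measurableSet_Icc, Set.inter_eq_left.2
    (Set.Icc_subset_Icc (by linarith) (by linarith))] at h
  exact h

theorem uniformMiddleAlgorithm_expectedError_le {f : I → ℝ} (hf : LipschitzWith 1 f) :
    uniformMiddleAlgorithm.expectedError f ≤ ENNReal.ofReal (1 - √3 / 2) := by
  have hs : √3 ^ 2 = 3 := Real.sq_sqrt (by norm_num)
  have hs1 : 1.732 < √3 := Real.lt_sqrt_of_sq_lt (by norm_num)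
  have hs2 : √3 < 1.7321 := (Real.sqrt_lt' (by norm_num)).2 (by norm_num)
  obtain ⟨F, hF, hFf⟩ : ∃ F : ℝ → ℝ, LipschitzWith 1 F ∧ ∀ x : I, f x = F x + avg f := by
    refine ⟨fun x => f (Set.projIcc 0 1 zero_le_one x) - avg f, ?_, fun x => by simp⟩
    have h := hf.comp (LipschitzWith.projIcc (zero_le_one (α := ℝ)))
    rw [one_mul] at h
    exact LipschitzWith.of_dist_le_mul fun x y => by
      rw [dist_sub_right]
      exact h.dist_le_mul x y
  have hF0 : ∫ x in (0 : ℝ)..1, F x = 0 := by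
    have h1 : avg f = ∫ x in (0 : ℝ)..1, (F x + avg f) := by
      rw [← avg_comp_coe]
      exact congrArg avg (funext hFf)
    rw [intervalIntegral.integral_add (hF.continuous.intervalIntegrable _ _) (by simp)] at h1
    simpa using h1
  have hb := integral_abs_middle_le hF (a := 2 - √3) (by linear_combination hs) (by linarith)
    (by linarith) hF0
  rw [show 1 - (2 - √3) = √3 - 1 by ring, intervalIntegral.integral_of_le (by linarith),
    ← integral_Icc_eq_integral_Ioc] at hb
  have hpos : 0 < 1 - 2 * (2 - √3) := by linarith
  calc uniformMiddleAlgorithm.expectedError f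
      = (volume middleInterval)⁻¹ * ∫⁻ x in middleInterval, ENNReal.ofReal |F x| := by
        simp only [SamplingAlgorithm.expectedError, uniformMiddleAlgorithm, uniformMiddle,
          ProbabilityTheory.cond, ProbabilityMeasure.coe_mk, lintegral_smul_measure, smul_eq_mul,
          hFf, add_sub_cancel_right]
    _ = (ENNReal.ofReal (1 - 2 * (2 - √3)))⁻¹ *
          ENNReal.ofReal (∫ x in Set.Icc (2 - √3) (√3 - 1), |F x|) := by
        rw [volume_middleInterval, lintegral_middleInterval fun x => ENNReal.ofReal |F x|,
          ofReal_integral_eq_lintegral_ofReal hF.continuous.abs.integrableOn_Icc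
            (.of_forall fun x => abs_nonneg _)]
    _ ≤ (ENNReal.ofReal (1 - 2 * (2 - √3)))⁻¹ *
          ENNReal.ofReal ((1 - 2 * (2 - √3)) * (2 - √3) / 2) := by gcongr
    _ = ENNReal.ofReal (1 - √3 / 2) := by
        rw [← ENNReal.ofReal_inv_of_pos hpos, ← ENNReal.ofReal_mul (by positivity)]
        congr 1
        field_simp

/-! ### Lower bound for every algorithm -/

/-- Substitute y = s + k for the reading; since |s| ≤ 1, a window shorter by 1 at each end suffices.
-/
theorem lintegral_abs_sub_translate_ge (φ : ℝ → ℝ) {s : ℝ} (hs : |s| ≤ 1) (M : ℝ) :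
    ∫⁻ y in Set.Icc (-(M - 1)) (M - 1), ENNReal.ofReal |φ y - y + s| ≤
      ∫⁻ k in Set.Icc (-M) M, ENNReal.ofReal |φ (s + k) - k| := by
  have h := (measurePreserving_add_left volume s).setLIntegral_comp_preimage_emb
    (measurableEmbedding_addLeft s) (fun y => ENNReal.ofReal |φ y - y + s|)
    (Set.Icc (-(M - 1)) (M - 1))
  rw [← h]
  have hs' := abs_le.1 hs
  refine (lintegral_mono_set fun k hk => ?_).trans_eq
    (lintegral_congr fun k => by congr 2; ring)
  have h1 : -(M - 1) ≤ s + k := hk.1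
  have h2 : s + k ≤ M - 1 := hk.2
  exact ⟨by linarith, by linarith⟩

/-- The same reading y arises from the means y - s and y + s, which are 2|s| apart, so the triangle
inequality applies pointwise. -/
theorem lintegral_abs_sub_add_neg_ge {φ : ℝ → ℝ} (hφ : Measurable φ) {s : ℝ} (hs : |s| ≤ 1)
    (M : ℝ) :
    ENNReal.ofReal (2 * |s|) * ENNReal.ofReal (2 * (M - 1)) ≤
      (∫⁻ k in Set.Icc (-M) M, ENNReal.ofReal |φ (s + k) - k|) +
        ∫⁻ k in Set.Icc (-M) M, ENNReal.ofReal |φ (-s + k) - k| := by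
  refine le_trans ?_ (add_le_add (lintegral_abs_sub_translate_ge φ hs M)
    (lintegral_abs_sub_translate_ge φ (by rwa [abs_neg]) M))
  rw [← lintegral_add_left (by fun_prop)]
  calc ENNReal.ofReal (2 * |s|) * ENNReal.ofReal (2 * (M - 1))
      = ∫⁻ _ in Set.Icc (-(M - 1)) (M - 1), ENNReal.ofReal (2 * |s|) := by
        rw [setLIntegral_const, Real.volume_Icc]; congr 2; ring
    _ ≤ _ := by
        refine lintegral_mono fun y => ?_
        rw [← ENNReal.ofReal_add (abs_nonneg _) (abs_nonneg _)]
        refine ENNReal.ofReal_le_ofReal ?_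
        have := abs_sub (φ y - y + s) (φ y - y + -s)
        rw [show φ y - y + s - (φ y - y + -s) = 2 * s by ring, abs_mul, abs_two] at this
        exact this

namespace SamplingAlgorithm

theorem lintegral_shift_le (A : SamplingAlgorithm) {h : I → ℝ} (hh : LipschitzWith 1 h)
    (h0 : avg h = 0) (M : ℝ) :
    ∫⁻ x, ∫⁻ k in Set.Icc (-M) M, ENNReal.ofReal |A.predict x (h x + k) - k|
        ∂volume ∂(A.law : Measure I) ≤
      A.worstCaseError * ENNReal.ofReal (2 * M) := by
  have hg := A.measurable_predict
  have hm : Measurable fun p : I × ℝ => A.predict p.1 (h p.1 + p.2) :=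
    hg.comp (measurable_fst.prodMk
      ((hh.continuous.measurable.comp measurable_fst).add measurable_snd))
  rw [lintegral_lintegral_swap (by
    exact (ENNReal.measurable_ofReal.comp (hm.sub measurable_snd).abs).aemeasurable)]
  calc _ ≤ ∫⁻ _ in Set.Icc (-M) M, A.worstCaseError := by
        refine lintegral_mono fun k => ?_
        have hk : LipschitzWith 1 fun x => h x + k := LipschitzWith.of_dist_le_mul fun x y => by
          rw [dist_add_right]
          exact hh.dist_le_mul x y
        have hint : Integrable h := hh.continuous.integrable_of_hasCompactSupport
          (HasCompactSupport.of_compactSpace _)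
        have havg : avg (fun x => h x + k) = k := by
          rw [avg] at h0 ⊢
          rw [integral_add hint (integrable_const k), h0]
          simp
        refine le_trans (le_of_eq ?_)
          (le_iSup (fun f : {f : I → ℝ // LipschitzWith 1 f} => A.expectedError f) ⟨_, hk⟩)
        simp only [expectedError, havg]
    _ = _ := by
        rw [setLIntegral_const, Real.volume_Icc]; congr 2; ring

theorem lintegral_abs_le (A : SamplingAlgorithm) {h : I → ℝ} (hh : LipschitzWith 1 h)
    (h0 : avg h = 0) (h1 : ∀ x, |h x| ≤ 1) (M : ℝ) :
    (∫⁻ x, ENNReal.ofReal (2 * |h x|) ∂(A.law : Measure I)) * ENNReal.ofReal (2 * (M - 1)) ≤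
      2 * (A.worstCaseError * ENNReal.ofReal (2 * M)) := by
  have hn := A.lintegral_shift_le hh.neg (by simpa [avg, integral_neg] using h0) M
  have hp := A.lintegral_shift_le hh h0 M
  have hg := A.measurable_predict
  have hm : Measurable fun p : I × ℝ => A.predict p.1 (h p.1 + p.2) :=
    hg.comp (measurable_fst.prodMk
      ((hh.continuous.measurable.comp measurable_fst).add measurable_snd))
  have hhm := hh.continuous.measurable
  rw [← lintegral_mul_const _ (by fun_prop), two_mul (A.worstCaseError * _)]
  refine le_trans ?_ (add_le_add hp hn)
  rw [← lintegral_add_left (Measurable.lintegral_prod_right' (f := fun p : I × ℝ =>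
    ENNReal.ofReal |A.predict p.1 (h p.1 + p.2) - p.2|)
    (ENNReal.measurable_ofReal.comp (hm.sub measurable_snd).abs))]
  exact lintegral_mono fun x =>
    lintegral_abs_sub_add_neg_ge (hg.comp measurable_prodMk_left) (h1 x) M

end SamplingAlgorithm

theorem integral_abs_sub_zero_one {c : ℝ} (h0 : 0 ≤ c) (h1 : c ≤ 1) :
    ∫ x in (0 : ℝ)..1, |x - c| = (c ^ 2 + (1 - c) ^ 2) / 2 := by
  have hi : ∀ p q, IntervalIntegrable (fun x => |x - c|) volume p q := fun p q =>
    Continuous.intervalIntegrable (by fun_prop) _ _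
  rw [← intervalIntegral.integral_add_adjacent_intervals (hi 0 c) (hi c 1),
    integral_abs_of_nonpos (F := fun x => x - c) h0 fun x hx => by linarith [hx.2],
    integral_abs_of_nonneg (F := fun x => x - c) h1 fun x hx => by linarith [hx.1]]
  rw [intervalIntegral.integral_sub (by simp) (by simp),
    intervalIntegral.integral_sub (by simp) (by simp)]
  simp only [integral_id, intervalIntegral.integral_const, smul_eq_mul]
  ring

/-- For a ≥ 0 the centres are a apart, so each is a zero of the other function, and between them
equality holds. -/
theorem abs_add_abs_ge (a x : ℝ) :
    a ≤ |(|x - (1 - a) / 2| - a)| + |(|x - (1 + a) / 2| - a)| := by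
  rcases abs_cases (x - (1 - a) / 2) with h1 | h1 <;>
  rcases abs_cases (x - (1 + a) / 2) with h2 | h2 <;>
  rcases abs_cases (|x - (1 - a) / 2| - a) with h3 | h3 <;>
  rcases abs_cases (|x - (1 + a) / 2| - a) with h4 | h4 <;> linarith

theorem SamplingAlgorithm.worstCaseError_ge (A : SamplingAlgorithm) :
    ENNReal.ofReal (1 - √3 / 2) ≤ A.worstCaseError := by
  have hs : √3 ^ 2 = 3 := Real.sq_sqrt (by norm_num)
  have hs1 : 1.732 < √3 := Real.lt_sqrt_of_sq_lt (by norm_num)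
  have hs2 : √3 < 1.7321 := (Real.sqrt_lt' (by norm_num)).2 (by norm_num)
  obtain ⟨a, ha⟩ : ∃ a, a = 2 - √3 := ⟨_, rfl⟩
  have hsa : √3 = 2 - a := by linarith
  rw [hsa] at hs hs1 hs2 ⊢
  have hlip : ∀ c, LipschitzWith 1 fun x : I => |(x : ℝ) - c| - a := fun c =>
    LipschitzWith.of_dist_le_mul fun x y => by
      rw [dist_sub_right, NNReal.coe_one, one_mul, Real.dist_eq, Subtype.dist_eq, Real.dist_eq]
      refine (abs_abs_sub_abs_le _ _).trans_eq ?_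
      congr 1; ring
  have havg : ∀ c, 0 ≤ c → c ≤ 1 → (c ^ 2 + (1 - c) ^ 2) / 2 = a →
      avg (fun x : I => |(x : ℝ) - c| - a) = 0 := fun c h0 h1 hc => by
    rw [avg_comp_coe fun x => |x - c| - a, intervalIntegral.integral_sub
      (Continuous.intervalIntegrable (by fun_prop) _ _) (by simp), integral_abs_sub_zero_one h0 h1]
    simp [hc]
  have hbd : ∀ c, 0 ≤ c → c ≤ 1 → ∀ x : I, |(|(x : ℝ) - c| - a)| ≤ 1 := fun c h0 h1 x => by
    have hx := x.2
    have : |(x : ℝ) - c| ≤ 1 := abs_le.2 ⟨by linarith [hx.1], by linarith [hx.2]⟩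
    exact abs_le.2 ⟨by linarith [abs_nonneg ((x : ℝ) - c)], by linarith⟩
  have hM : ∀ M : ℝ, ENNReal.ofReal (2 * a) * ENNReal.ofReal (2 * (M - 1)) ≤
      4 * (A.worstCaseError * ENNReal.ofReal (2 * M)) := fun M => by
    have e1 := A.lintegral_abs_le (hlip ((1 - a) / 2))
      (havg _ (by linarith) (by linarith) (by linear_combination hs / 4))
      (hbd _ (by linarith) (by linarith)) M
    have e2 := A.lintegral_abs_le (hlip ((1 + a) / 2))
      (havg _ (by linarith) (by linarith) (by linear_combination hs / 4))
      (hbd _ (by linarith) (by linarith)) M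
    have e3 := add_le_add e1 e2
    rw [← add_mul, ← add_mul, ← lintegral_add_left (by fun_prop)] at e3
    norm_num only at e3
    refine le_trans (mul_le_mul_left ?_ _) e3
    calc ENNReal.ofReal (2 * a) = ∫⁻ _, ENNReal.ofReal (2 * a) ∂(A.law : Measure I) := by simp
      _ ≤ _ := by
        refine lintegral_mono fun x => ?_
        rw [← ENNReal.ofReal_add (by positivity) (by positivity)]
        refine ENNReal.ofReal_le_ofReal ?_
        linarith [abs_add_abs_ge a x]
  rcases eq_or_ne A.worstCaseError ⊤ with htop | htop
  · simp [htop]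
  obtain ⟨w, hw0, hw⟩ : ∃ w : ℝ, 0 ≤ w ∧ A.worstCaseError = ENNReal.ofReal w :=
    ⟨_, ENNReal.toReal_nonneg, (ENNReal.ofReal_toReal htop).symm⟩
  rw [hw]
  refine ENNReal.ofReal_le_ofReal ?_
  by_contra! hlt
  have hd : 0 < a / 2 - w := by linarith
  have hq : 0 < a / 2 / (a / 2 - w) := div_pos (by linarith) hd
  -- This M makes (a/2 - w)(M - 1) = a/2, whereas `hM` forces it to be at most w < a/2.
  have h := hM (a / 2 / (a / 2 - w) + 1)
  rw [hw, show (4 : ℝ≥0∞) = ENNReal.ofReal 4 by simp, ← ENNReal.ofReal_mul (by linarith),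
    ← ENNReal.ofReal_mul hw0, ← ENNReal.ofReal_mul (by norm_num),
    ENNReal.ofReal_le_ofReal_iff (by positivity)] at h
  have hq1 : a / 2 / (a / 2 - w) * (a / 2 - w) = a / 2 := div_mul_cancel₀ _ hd.ne'
  linarith

theorem mainTheorem1 :
    (∀ A : SamplingAlgorithm,
      uniformMiddleAlgorithm.worstCaseError ≤ A.worstCaseError) ∧
    uniformMiddleAlgorithm.worstCaseError = ENNReal.ofReal (1 - √3 / 2) ∧
    |(1 - √3 / 2) - 0.134| < 0.0005 := by
  have hle : uniformMiddleAlgorithm.worstCaseError ≤ ENNReal.ofReal (1 - √3 / 2) :=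
    iSup_le fun f => uniformMiddleAlgorithm_expectedError_le f.2
  have hs1 : 1.732 < √3 := Real.lt_sqrt_of_sq_lt (by norm_num)
  have hs2 : √3 < 1.7321 := (Real.sqrt_lt' (by norm_num)).2 (by norm_num)
  exact ⟨fun A => hle.trans A.worstCaseError_ge,
    hle.antisymm uniformMiddleAlgorithm.worstCaseError_ge,
    abs_lt.2 ⟨by linarith, by linarith⟩⟩
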